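/- Let $$q(a,b,c) = -c^3 - c^2(a+b) + c(a^2+ab+b^2) + (a^3+a^2b+ab^2+b^3),$$ and let $\mathcal{E}$ be the curve $q(a,b,c)=0$ in the projective plane with homogeneous coordinates $(a:b:c)$. The bisectral triangle of a triangle $ABC$ in the Euclidean plane is the triangle whose vertices are the points where the internal angle bisectors of $ABC$ meet the opposite sides. A Sharygin triangle is a (nondegenerate) scalene triangle whose bisectral triangle is isosceles, i.e. has at least two equal sides. Theorem. (1) The rational points $\mathcal{E}(\mathbb{Q})$ are dense in the set of real points $\mathcal{E}(\mathbb{R})$ in the usual topology of $\mathbb{P}^2(\mathbb{R})$; that is, the closure of $\mathcal{E}(\mathbb{Q})$ in $\mathbb{P}^2(\mathbb{R})$ is $\mathcal{E}(\mathbb{R})$. (2) There are infinitely many pairwise non-similar Sharygin triangles all of whose side lengths are integers. -/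

import Mathlib

open scoped LinearAlgebra.Projectivization EuclideanGeometry

namespace Sharygin

/-! ### The cubic curve -/

/-- The cubic form `q(a,b,c)`, where `v = (a,b,c)`. -/
noncomputable def q {R : Type*} [CommRing R] (v : Fin 3 → R) : R :=
  -(v 2) ^ 3 - (v 2) ^ 2 * (v 0 + v 1) + v 2 * ((v 0) ^ 2 + v 0 * v 1 + (v 1) ^ 2)
    + ((v 0) ^ 3 + (v 0) ^ 2 * v 1 + v 0 * (v 1) ^ 2 + (v 1) ^ 3)

theorem q_smul {R : Type*} [CommRing R] (t : R) (v : Fin 3 → R) : q (t • v) = t ^ 3 * q v := by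
  simp only [q, Pi.smul_apply, smul_eq_mul]
  ring

/-- The set of `K`-points of the plane projective curve `q(a,b,c) = 0`. -/
noncomputable def curve (K : Type*) [Field K] : Set (ℙ K (Fin 3 → K)) :=
  {P | P.lift (fun v => q v.1 = 0) (by
    rintro ⟨v, hv⟩ ⟨w, hw⟩ t h
    have h' : v = t • w := h
    have ht : t ≠ 0 := by
      rintro rfl
      exact hv (by simpa using h')
    simp [h', q_smul, ht])}

/-- The coordinatewise inclusion of `ℚ³` into `ℝ³`, as a semilinear map. -/
noncomputable def coordCast : (Fin 3 → ℚ) →ₛₗ[algebraMap ℚ ℝ] (Fin 3 → ℝ) where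
  toFun v i := (v i : ℝ)
  map_add' v w := by
    ext i
    simp
  map_smul' t v := by
    ext i
    simp

theorem coordCast_injective : Function.Injective coordCast := by
  intro v w h
  ext i
  have h' : ((v i : ℚ) : ℝ) = (w i : ℝ) := congrFun h i
  exact_mod_cast h'

/-- The natural map from the rational projective plane to the real projective plane. -/
noncomputable def ratToReal : ℙ ℚ (Fin 3 → ℚ) → ℙ ℝ (Fin 3 → ℝ) :=
  Projectivization.map coordCast coordCast_injective

/-- The usual topology of the real projective plane: the quotient topology from `ℝ³ ∖ {0}`. -/
noncomputable instance realPlaneTopology : TopologicalSpace (ℙ ℝ (Fin 3 → ℝ)) :=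
  TopologicalSpace.coinduced
    (Projectivization.mk' ℝ : {v : Fin 3 → ℝ // v ≠ 0} → ℙ ℝ (Fin 3 → ℝ)) inferInstance

/-! ### Triangles -/

/-- The Euclidean plane. -/
abbrev Plane := EuclideanSpace ℝ (Fin 2)

/-- A nondegenerate triangle in the Euclidean plane, with labelled vertices. -/
abbrev PlaneTriangle := Affine.Triangle ℝ Plane

/-- The length of the side opposite to the vertex `i`. -/
noncomputable def side (T : PlaneTriangle) (i : Fin 3) : ℝ :=
  dist (T.points (i + 1)) (T.points (i + 2))

/-- All three sides have different lengths. -/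
def IsScalene (T : PlaneTriangle) : Prop :=
  Function.Injective (side T)

/-- At least two sides have equal lengths. -/
def IsIsosceles (T : PlaneTriangle) : Prop :=
  ∃ i j : Fin 3, i ≠ j ∧ side T i = side T j

/-- `T'` is the bisectral triangle of `T`: for each `i`, the vertex `i` of `T'` is the point where
the internal bisector of `T` at the vertex `i` meets the opposite side. -/
def IsBisectral (T T' : PlaneTriangle) : Prop :=
  ∀ i : Fin 3,
    Sbtw ℝ (T.points (i + 1)) (T'.points i) (T.points (i + 2)) ∧
      ∠ (T.points (i + 1)) (T.points i) (T'.points i) =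
        ∠ (T'.points i) (T.points i) (T.points (i + 2))

/-- A scalene triangle whose bisectral triangle is isosceles. -/
def IsSharygin (T : PlaneTriangle) : Prop :=
  IsScalene T ∧ ∃ T' : PlaneTriangle, IsBisectral T T' ∧ IsIsosceles T'

/-- All side lengths are integers. -/
def IsInteger (T : PlaneTriangle) : Prop :=
  ∀ i : Fin 3, ∃ n : ℤ, side T i = n

/-- Similarity of triangles, for some matching of their vertices. -/
def AreSimilar (T₁ T₂ : PlaneTriangle) : Prop :=
  ∃ σ : Equiv.Perm (Fin 3), Similar (T₁.points ∘ σ) T₂.points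

end Sharygin

/-!
The linear change of coordinates `x = 6c / u + 2`, `y = 12(a - b) / u` with `u = 2(a + b) + c`
identifies the cubic `q = 0` with the Weierstrass curve `y² = f(x)`, where `f(x) = x³ + 5x² - 32x`;
the point at infinity is the rational inflection point `(1 : -1 : 0)`. Everything reduces to the set
`X` of abscissae of rational points of this curve, and of its group law only the explicit formulas
are needed: `X` is closed under doubling, under translation by the point `(0, 0)` of order two,
`x ↦ -32 / x`, and under the operations `x(P ± Q)` (`chord_mem_ratAbscissa`).

* `X` contains infinitely many positive elements, since doubling a point with even denominator
  multiplies the 2-adic norm of its abscissa by four (`padicNorm_double`).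
* `X` is unbounded (`exists_lt_mem_realAbscissa`): two positive abscissae `x`, `x'` of points `P`,
  `Q` satisfy `x(P + Q) x(P - Q) = ((x x' + 32) / (x - x'))²`, which is large when `x` and `x'` are
  close.
* `X` is dense in the set where `f ≥ 0` (`mem_closure_realAbscissa`). If `Q` is a rational point
  close to infinity, then `x(P + Q)` and `x(P - Q)` are close to `x(P)` and on different sides of it,
  by `chord_neg_sub_chord` and `chord_sub_mul_chord_sub`; so repeated translation by `Q` moves
  rational points through the identity component in small steps. Translation by `(0, 0)` carries the
  density over to the other component.

The Sharygin triangles come from the arc `y < 0`, `39/10 < x < 4`, where `a < b < c < a + b`. By the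
law of cosines, `q(a, b, c) = 0` makes two sides of the bisectral triangle equal
(`isIsosceles_bisectralTriangle`). The arc has infinitely many rational points by density, and
triangles from different points are not similar, because their sides are sorted and not
proportional.
-/

namespace Sharygin

/-! ### Rational abscissae on the Weierstrass model -/

/-- The right-hand side of the Weierstrass equation `y² = x³ + 5x² - 32x` of the curve `q = 0`. -/
def cubic {R : Type*} [CommRing R] (x : R) : R := x ^ 3 + 5 * x ^ 2 - 32 * x

/-- The set of the abscissae of the affine rational points of `y² = x³ + 5x² - 32x`. -/
def ratAbscissa : Set ℚ := {x | ∃ y, y ^ 2 = cubic x}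

/-- The abscissa of the sum of the points `(x, y)` and `(x', y')` of the Weierstrass curve. -/
noncomputable def chord {K : Type*} [Field K] (x y x' y' : K) : K :=
  ((y - y') / (x - x')) ^ 2 - 5 - x - x'

/-- The third intersection of the chord through two points lies on the curve. -/
theorem chord_mem_ratAbscissa {x y x' y' : ℚ} (hx : x ≠ x') (h : y ^ 2 = cubic x)
    (h' : y' ^ 2 = cubic x') : chord x y x' y' ∈ ratAbscissa := by
  obtain ⟨m, hm⟩ : ∃ m, m = (y - y') / (x - x') := ⟨_, rfl⟩
  have hx' : x - x' ≠ 0 := sub_ne_zero.2 hx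
  have hy : y = y' + m * (x - x') := by
    rw [hm, div_mul_cancel₀ _ hx']
    ring
  refine ⟨m * (chord x y x' y' - x') + y', mul_left_cancel₀ hx' ?_⟩
  simp only [chord, ← hm]
  simp only [cubic] at h h' ⊢
  rw [hy] at h
  linear_combination (m ^ 2 - 5 - x - 2 * x') * h - (m ^ 2 - 5 - 2 * x - x') * h'

theorem double_mem_ratAbscissa {x : ℚ} (hx : x ∈ ratAbscissa) (h0 : cubic x ≠ 0) :
    (x ^ 2 + 32) ^ 2 / (4 * cubic x) ∈ ratAbscissa := by
  obtain ⟨y, hy⟩ := hx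
  have hy0 : y ≠ 0 := by
    rintro rfl
    exact h0 (by rw [← hy]; ring)
  -- the tangent at `(x, y)` has slope `(3x² + 10x - 32) / 2y`
  refine ⟨(3 * x ^ 2 + 10 * x - 32) / (2 * y) * ((x ^ 2 + 32) ^ 2 / (4 * y ^ 2) - x) + y, ?_⟩
  rw [← hy]
  have e : (x ^ 2 + 32) ^ 2 / (4 * y ^ 2) =
      ((3 * x ^ 2 + 10 * x - 32) / (2 * y)) ^ 2 - 5 - 2 * x := by
    field_simp
    rw [hy]
    simp only [cubic]
    ring
  rw [e]
  obtain ⟨m, hm⟩ : ∃ m, m = (3 * x ^ 2 + 10 * x - 32) / (2 * y) := ⟨_, rfl⟩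
  have hm' : 2 * y * m = 3 * x ^ 2 + 10 * x - 32 := by
    rw [hm]
    field_simp
  rw [← hm]
  simp only [cubic] at hy ⊢
  linear_combination hy + (m ^ 2 - 5 - 3 * x) * hm'

/-- Translation by the point `(0, 0)` of order two. -/
theorem neg_div_mem_ratAbscissa {x : ℚ} (hx : x ∈ ratAbscissa) (h0 : x ≠ 0) :
    -32 / x ∈ ratAbscissa := by
  obtain ⟨y, hy⟩ := hx
  refine ⟨32 * y / x ^ 2, ?_⟩
  simp only [cubic] at hy ⊢
  field_simp
  linear_combination hy

/-- Doubling a point with even denominator multiplies the 2-adic norm of its abscissa by four. -/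
theorem padicNorm_double {x : ℚ} (hx : 1 < padicNorm 2 x) :
    padicNorm 2 ((x ^ 2 + 32) ^ 2 / (4 * cubic x)) = 4 * padicNorm 2 x := by
  have hpow : ∀ (a : ℚ) (n : ℕ), padicNorm 2 (a ^ n) = padicNorm 2 a ^ n := fun a n => by
    induction n with
    | zero => simp
    | succ n ih => rw [pow_succ, padicNorm.mul, ih, pow_succ]
  have hint : ∀ z : ℤ, padicNorm 2 z ≤ 1 := padicNorm.of_int
  have h1 : padicNorm 2 (x ^ 2 + 32) = padicNorm 2 x ^ 2 := by
    have h := hint 32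
    have hlt : padicNorm 2 (32 : ℚ) < padicNorm 2 (x ^ 2) := by
      rw [hpow]
      refine lt_of_le_of_lt (by exact_mod_cast h) ?_
      nlinarith
    rw [padicNorm.add_eq_max_of_ne hlt.ne', max_eq_left hlt.le, hpow]
  have h2 : padicNorm 2 (x ^ 2 + (5 * x + (-32))) = padicNorm 2 x ^ 2 := by
    have h := hint (-32)
    have h5 := hint 5
    have hlt : padicNorm 2 (5 * x + (-32) : ℚ) < padicNorm 2 (x ^ 2) := by
      refine lt_of_le_of_lt padicNorm.nonarchimedean (max_lt ?_ ?_)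
      · rw [hpow, padicNorm.mul]
        push_cast at h5
        nlinarith
      · rw [hpow]
        push_cast at h
        nlinarith
    rw [padicNorm.add_eq_max_of_ne hlt.ne', max_eq_left hlt.le, hpow]
  have h4 : padicNorm 2 (4 : ℚ) = 1 / 4 := by
    have : padicNorm 2 (2 : ℚ) = 2⁻¹ := by exact_mod_cast padicNorm.padicNorm_p_of_prime (p := 2)
    rw [show (4 : ℚ) = 2 ^ 2 by norm_num, hpow, this]
    norm_num
  have h3 : cubic x = x * (x ^ 2 + (5 * x + (-32))) := by
    simp only [cubic]
    ring
  rw [padicNorm.div, padicNorm.mul, hpow, h1, h4, h3, padicNorm.mul, h2]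
  have : padicNorm 2 x ≠ 0 := by linarith
  field_simp

theorem infinite_pos_ratAbscissa : {x | x ∈ ratAbscissa ∧ 0 < x}.Infinite := by
  let s : Set ℚ := {x | x ∈ ratAbscissa ∧ 0 < x ∧ 1 < padicNorm 2 x}
  suffices h : s.Infinite from h.mono fun x hx => ⟨hx.1, hx.2.1⟩
  intro hfin
  -- twice the point with abscissa `-1`
  have hne : s.Nonempty := by
    refine ⟨121 / 16, ⟨11 * 127 / 64, by norm_num [cubic]⟩, by norm_num, ?_⟩
    have h2 : padicNorm 2 (2 : ℚ) = 2⁻¹ := by exact_mod_cast padicNorm.padicNorm_p_of_prime (p := 2)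
    have h121 : padicNorm 2 (121 : ℚ) = 1 := by
      exact_mod_cast (padicNorm.nat_eq_one_iff (p := 2) 121).2 (by norm_num)
    rw [padicNorm.div, h121, show (16 : ℚ) = 2 * 2 * (2 * 2) by norm_num]
    simp only [padicNorm.mul, h2]
    norm_num
  obtain ⟨x, ⟨hx, h0, h1⟩, hmax⟩ := Set.exists_max_image s (padicNorm 2) hfin hne
  have hc : cubic x ≠ 0 := by
    intro h
    have := padicNorm_double h1
    rw [h, mul_zero, div_zero, padicNorm.zero] at this
    linarith
  have hpos : 0 < cubic x := by
    obtain ⟨y, hy⟩ := hx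
    exact lt_of_le_of_ne (hy ▸ sq_nonneg y) hc.symm
  have := hmax _ ⟨double_mem_ratAbscissa hx hc, by positivity, by rw [padicNorm_double h1]; linarith⟩
  rw [padicNorm_double h1] at this
  linarith

/-! ### Density of the rational abscissae -/

/-- The set of the abscissae of the affine rational points of `y² = x³ + 5x² - 32x`, as a set of
real numbers. -/
def realAbscissa : Set ℝ := (fun x : ℚ => (x : ℝ)) '' ratAbscissa

theorem cast_cubic (x : ℚ) : ((cubic x : ℚ) : ℝ) = cubic (x : ℝ) := by
  simp [cubic]

theorem exists_sqrt_cubic_eq {x : ℚ} (hx : x ∈ ratAbscissa) :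
    ∃ y : ℚ, y ^ 2 = cubic x ∧ √(cubic (x : ℝ)) = y := by
  obtain ⟨y, hy⟩ := hx
  refine ⟨|y|, by rw [sq_abs, hy], ?_⟩
  rw [← cast_cubic, ← hy]
  push_cast
  exact Real.sqrt_sq_eq_abs _

theorem cubic_nonneg {x : ℝ} (hx : x ∈ realAbscissa) : 0 ≤ cubic x := by
  obtain ⟨x, ⟨y, hy⟩, rfl⟩ := hx
  rw [← cast_cubic, ← hy]
  positivity

/-- The real points of the Weierstrass curve have abscissa greater than `-9`. -/
theorem neg_nine_lt {x : ℝ} (hx : 0 ≤ cubic x) : -9 < x := by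
  by_contra! h
  simp only [cubic] at hx
  nlinarith [sq_nonneg (x + 9)]

theorem chord_sub_mem {x x' : ℝ} (hx : x ∈ realAbscissa) (hx' : x' ∈ realAbscissa) (h : x ≠ x') :
    chord x √(cubic x) x' √(cubic x') ∈ realAbscissa := by
  obtain ⟨x, hx, rfl⟩ := hx
  obtain ⟨x', hx', rfl⟩ := hx'
  obtain ⟨y, hy, e⟩ := exists_sqrt_cubic_eq hx
  obtain ⟨y', hy', e'⟩ := exists_sqrt_cubic_eq hx'
  refine ⟨_, chord_mem_ratAbscissa (fun hh => h (by rw [hh])) hy hy', ?_⟩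
  simp only [chord, e, e']
  push_cast
  rfl

theorem chord_add_mem {x x' : ℝ} (hx : x ∈ realAbscissa) (hx' : x' ∈ realAbscissa) (h : x ≠ x') :
    chord x √(cubic x) x' (-√(cubic x')) ∈ realAbscissa := by
  obtain ⟨x, hx, rfl⟩ := hx
  obtain ⟨x', hx', rfl⟩ := hx'
  obtain ⟨y, hy, e⟩ := exists_sqrt_cubic_eq hx
  obtain ⟨y', hy', e'⟩ := exists_sqrt_cubic_eq hx'
  refine ⟨_, chord_mem_ratAbscissa (y' := -y') (fun hh => h (by rw [hh])) hy
    (by rw [neg_sq, hy']), ?_⟩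
  simp only [chord, e, e']
  push_cast
  rfl

/-- The product of the abscissae of the sum and the difference of two points. -/
theorem chord_mul_chord {x y x' y' : ℝ} (h : x ≠ x') (hy : y ^ 2 = cubic x)
    (hy' : y' ^ 2 = cubic x') :
    chord x y x' y' * chord x y x' (-y') = ((x * x' + 32) / (x - x')) ^ 2 := by
  have h' : x - x' ≠ 0 := sub_ne_zero.2 h
  have e : chord x y x' y' =
      (x * x' * (x + x' + 10) - 32 * (x + x') - 2 * (y * y')) / (x - x') ^ 2 := by
    simp only [chord, cubic] at *
    field_simp
    linear_combination hy + hy'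
  have e' : chord x y x' (-y') =
      (x * x' * (x + x' + 10) - 32 * (x + x') + 2 * (y * y')) / (x - x') ^ 2 := by
    simp only [chord, cubic] at *
    field_simp
    linear_combination hy + hy'
  have e2 : (y * y') ^ 2 = cubic x * cubic x' := by rw [mul_pow, hy, hy']
  rw [e, e']
  simp only [cubic] at e2
  field_simp
  linear_combination (-4) * e2

theorem chord_neg_sub_chord (x y x' y' : ℝ) :
    chord x y x' (-y') - chord x y x' y' = 4 * (y * y') / (x - x') ^ 2 := by
  simp only [chord, div_pow]
  ring

/-- The sum and the difference with a point `(x', y')` lie on different sides of `(x, y)` as soon as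
`x'` exceeds the abscissa of the double of `(x, y)`. -/
theorem chord_sub_mul_chord_sub {x y x' y' : ℝ} (h : x ≠ x') (hy : y ^ 2 = cubic x)
    (hy' : y' ^ 2 = cubic x') :
    (chord x y x' y' - x) * (chord x y x' (-y') - x) =
      ((x ^ 2 + 32) ^ 2 - 4 * cubic x * x') / (x - x') ^ 2 := by
  have h' : x - x' ≠ 0 := sub_ne_zero.2 h
  have e : (chord x y x' y' - x) * (chord x y x' (-y') - x) = chord x y x' y' * chord x y x' (-y')
      - x * (chord x y x' y' + chord x y x' (-y')) + x ^ 2 := by ring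
  have e' : chord x y x' y' + chord x y x' (-y') =
      2 * (cubic x + cubic x') / (x - x') ^ 2 - 2 * (5 + x + x') := by
    simp only [chord, div_pow]
    rw [← hy, ← hy']
    ring
  rw [e, chord_mul_chord h hy hy', e']
  simp only [cubic]
  field_simp
  ring

theorem infinite_pos_realAbscissa : {x | x ∈ realAbscissa ∧ 0 < x}.Infinite := by
  refine (infinite_pos_ratAbscissa.image (f := fun x : ℚ => (x : ℝ))
    Rat.cast_injective.injOn).mono ?_
  rintro _ ⟨x, ⟨hx, h0⟩, rfl⟩
  exact ⟨⟨x, hx, rfl⟩, Rat.cast_pos.2 h0⟩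

/-- Two rational points with close abscissae have a sum or a difference near the point at
infinity. -/
theorem exists_lt_mem_realAbscissa (M : ℝ) : ∃ x ∈ realAbscissa, M < x := by
  by_contra! hM
  obtain ⟨x₀, hx₀, hp₀⟩ := infinite_pos_realAbscissa.nonempty
  have hM0 : 0 < M := hp₀.trans_le (hM _ hx₀)
  obtain ⟨ε, hε, hεM⟩ : ∃ ε > 0, ε * (M + 9) ≤ 32 :=
    ⟨32 / (M + 9), by positivity, by rw [div_mul_cancel₀ _ (by positivity)]⟩
  obtain ⟨x, ⟨hx, hx0⟩, x', ⟨hx', hx0'⟩, hne, hfl⟩ :=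
    infinite_pos_realAbscissa.exists_ne_map_eq_of_mapsTo (f := fun x => ⌊x / ε⌋)
      (t := Set.Icc 0 ⌊M / ε⌋) (fun x hx => ⟨Int.floor_nonneg.2 (by have := hx.2; positivity),
        Int.floor_le_floor (by have := hM x hx.1; gcongr)⟩) (Set.finite_Icc _ _)
  have hclose : |x - x'| < ε := by
    have := Int.abs_sub_lt_one_of_floor_eq_floor hfl
    rwa [← sub_div, abs_div, abs_of_pos hε, div_lt_one hε] at this
  have hs := chord_sub_mem hx hx' hne
  have ha := chord_add_mem hx hx' hne
  have hprod := chord_mul_chord hne (Real.sq_sqrt (cubic_nonneg hx)) (Real.sq_sqrt (cubic_nonneg hx'))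
  have hlt : ∀ z ∈ realAbscissa, |z| < M + 9 := fun z hz =>
    abs_lt.2 ⟨by linarith [neg_nine_lt (cubic_nonneg hz)], by linarith [hM z hz]⟩
  have hd : 0 < |x - x'| := abs_pos.2 (sub_ne_zero.2 hne)
  have h1 : (M + 9) < |(x * x' + 32) / (x - x')| := by
    rw [abs_div, lt_div_iff₀ hd, abs_of_pos (by positivity : 0 < x * x' + 32)]
    nlinarith [mul_pos hx0 hx0']
  have h2 := mul_lt_mul'' (hlt _ hs) (hlt _ ha) (abs_nonneg _) (abs_nonneg _)
  rw [← abs_mul, hprod, abs_pow] at h2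
  nlinarith

/-- The cubic is increasing on the range of abscissae of the identity component. -/
theorem cubic_lt_cubic {x z : ℝ} (hx : 0 < x) (hc : 0 ≤ cubic x) (h : x < z) :
    cubic x < cubic z := by
  have : 0 ≤ x ^ 2 + 5 * x - 32 := by
    by_contra! h'
    simp only [cubic] at hc
    nlinarith
  have h2 : x ^ 2 + 5 * x - 32 < z ^ 2 + 5 * z - 32 := by nlinarith
  simp only [cubic]
  nlinarith

/-- Adding to points in a bounded range a rational point close enough to infinity moves their
abscissae downwards, by less than a prescribed amount. -/
theorem exists_small_translation {α M ε : ℝ} (hα : 0 < α) (hc : 0 < cubic α) (hαM : α ≤ M)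
    (hε : 0 < ε) : ∃ x' ∈ realAbscissa, M < x' ∧ ∀ x ∈ Set.Icc α M,
      chord x √(cubic x) x' √(cubic x') < x ∧ x - ε < chord x √(cubic x) x' √(cubic x') := by
  have hmono : ∀ {u v : ℝ}, α ≤ u → u ≤ v → cubic u ≤ cubic v := fun {u v} hu huv => by
    have h0 : 0 ≤ cubic u := by
      rcases hu.eq_or_lt with h | h
      · exact h ▸ hc.le
      · exact hc.le.trans (cubic_lt_cubic hα hc.le h).le
    rcases huv.eq_or_lt with h | h
    · rw [h]
    · exact (cubic_lt_cubic (hα.trans_le hu) h0 h).le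
  have hM := hmono le_rfl hαM
  -- The bounds make `x'` exceed the doubled abscissa of every `x` in the range, and force
  -- `√(f(x) f(x'))` below `ε (x' / 2)² / 4`, using `f(x') ≤ 6 x'³`.
  obtain ⟨x', hx', hbig⟩ := exists_lt_mem_realAbscissa
    (max (max 1 (2 * M)) (max ((M ^ 2 + 32) ^ 2 / (4 * cubic α)) (1536 * cubic M / ε ^ 2)))
  simp only [max_lt_iff] at hbig
  obtain ⟨⟨h1, h2M⟩, hdouble, hsmall⟩ := hbig
  have hM0 : 0 < M := hα.trans_le hαM
  have hMx' : M < x' := by linarith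
  rw [div_lt_iff₀ (by positivity)] at hdouble hsmall
  refine ⟨x', hx', hMx', fun x ⟨hαx, hxM⟩ => ?_⟩
  have hx0 : 0 < x := hα.trans_le hαx
  have hcx : cubic α ≤ cubic x := hmono le_rfl hαx
  have hne : x ≠ x' := by linarith
  have hcx' : 0 ≤ cubic x' := cubic_nonneg hx'
  have hmul := chord_sub_mul_chord_sub hne (Real.sq_sqrt (hc.le.trans hcx)) (Real.sq_sqrt hcx')
  have hsub := chord_neg_sub_chord x √(cubic x) x' √(cubic x')
  have hd : 0 < (x - x') ^ 2 := by
    have := sub_ne_zero.2 hne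
    positivity
  have hneg : ((x ^ 2 + 32) ^ 2 - 4 * cubic x * x') / (x - x') ^ 2 < 0 := by
    refine div_neg_of_neg_of_pos ?_ hd
    have : (x ^ 2 + 32) ^ 2 ≤ (M ^ 2 + 32) ^ 2 := by gcongr
    have : cubic α * x' ≤ cubic x * x' := by gcongr
    linarith
  have hgap : 4 * (√(cubic x) * √(cubic x')) / (x - x') ^ 2 < ε := by
    rw [div_lt_iff₀ hd, ← Real.sqrt_mul (hc.le.trans hcx)]
    have hle : ε * (x' / 2) ^ 2 ≤ ε * (x - x') ^ 2 := by
      have : x' / 2 ≤ x' - x := by linarith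
      rw [← neg_sub x' x, neg_sq]
      gcongr
    have hlt : √(cubic x * cubic x') < ε * (x' / 2) ^ 2 / 4 := by
      rw [Real.sqrt_lt' (by positivity)]
      have e1 : cubic x' ≤ 6 * x' ^ 3 := by
        simp only [cubic]
        have : x' ^ 2 ≤ x' ^ 3 := pow_le_pow_right₀ h1.le (by norm_num)
        linarith
      have e2 : cubic x * cubic x' ≤ cubic M * (6 * x' ^ 3) :=
        mul_le_mul (hmono hαx hxM) e1 hcx' (hc.le.trans hM)
      have e3 : 1536 * cubic M * x' ^ 3 < x' * ε ^ 2 * x' ^ 3 := by gcongr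
      nlinarith
    linarith
  have hnn : 0 ≤ 4 * (√(cubic x) * √(cubic x')) / (x - x') ^ 2 := by positivity
  rw [← hmul] at hneg
  rw [← hsub] at hnn hgap
  rcases mul_neg_iff.1 hneg with ⟨h, h'⟩ | ⟨h, h'⟩
  · linarith
  · exact ⟨by linarith, by linarith⟩

theorem continuous_cubic : Continuous (cubic : ℝ → ℝ) := by
  unfold cubic
  fun_prop

/-- The rational abscissae are dense in the range of abscissae of the identity component. -/
theorem exists_mem_realAbscissa_Ioo {x₀ β : ℝ} (h0 : 0 < x₀) (hc : 0 ≤ cubic x₀) (h : x₀ < β) :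
    ∃ x ∈ realAbscissa, x₀ < x ∧ x < β := by
  obtain ⟨α, hα, hαβ⟩ := exists_between h
  have hα0 : 0 < α := h0.trans hα
  have hcα : 0 < cubic α := hc.trans_lt (cubic_lt_cubic h0 hc hα)
  obtain ⟨M, hM, hβM⟩ := exists_lt_mem_realAbscissa β
  obtain ⟨x', hx', hMx', hstep⟩ := exists_small_translation hα0 hcα (hαβ.trans hβM).le
    (sub_pos.2 hαβ)
  let s : Set ℝ := realAbscissa ∩ Set.Icc β M
  have hs : s.Nonempty := ⟨M, hM, hβM.le, le_rfl⟩
  have hbdd : BddBelow s := ⟨β, fun x hx => hx.2.1⟩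
  have hβ : β ≤ sInf s := le_csInf hs fun x hx => hx.2.1
  have hInfM : sInf s ≤ M := csInf_le hbdd ⟨hM, hβM.le, le_rfl⟩
  -- The translate of a point near the infimum of `s` lies below this infimum, hence below `β`.
  have hcont : ContinuousAt (fun x => chord x √(cubic x) x' √(cubic x')) (sInf s) := by
    have := continuous_cubic
    have hne : sInf s - x' ≠ 0 := by linarith
    unfold chord
    fun_prop (disch := assumption)
  have hev := hcont.eventually_lt_const (hstep _ ⟨hαβ.le.trans hβ, hInfM⟩).1
  obtain ⟨x, hxs, hx⟩ := (mem_closure_iff_frequently.1 (csInf_mem_closure hs hbdd)).and_eventually hev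
    |>.exists
  have hmem := chord_sub_mem hxs.1 hx' (by linarith [hxs.2.2])
  have hlow := (hstep x ⟨hαβ.le.trans hxs.2.1, hxs.2.2⟩).2
  refine ⟨_, hmem, by linarith [hxs.2.1], ?_⟩
  by_contra! hge
  have := csInf_le hbdd (a := chord x √(cubic x) x' √(cubic x'))
    ⟨hmem, hge, by linarith⟩
  linarith

theorem mem_closure_realAbscissa_of_pos {x : ℝ} (h0 : 0 < x) (hc : 0 ≤ cubic x) :
    x ∈ closure realAbscissa := by
  rw [Metric.mem_closure_iff]
  intro ε hε
  obtain ⟨z, hz, h1, h2⟩ := exists_mem_realAbscissa_Ioo h0 hc (lt_add_of_pos_right x hε)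
  exact ⟨z, hz, by rw [Real.dist_eq, abs_lt]; constructor <;> linarith⟩

theorem mem_closure_realAbscissa {x : ℝ} (hc : 0 ≤ cubic x) : x ∈ closure realAbscissa := by
  rcases lt_trichotomy x 0 with h | rfl | h
  · -- translation by the point of order two exchanges the two components
    have h' : 0 < -32 / x := div_pos_of_neg_of_neg (by norm_num) h
    have hc' : 0 ≤ cubic (-32 / x) := by
      have : cubic (-32 / x) = cubic x * (32 / x ^ 2) ^ 2 := by
        simp only [cubic]
        field_simp
        ring
      rw [this]
      positivity
    have hcont : ContinuousAt (fun z : ℝ => -32 / z) (-32 / x) := by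
      have := h'.ne'
      fun_prop (disch := assumption)
    have hx : -32 / (-32 / x) = x := by
      field_simp
    refine hx ▸ closure_mono ?_ (hcont.continuousWithinAt.mem_closure_image
      (s := realAbscissa \ {0}) ?_)
    · rintro _ ⟨_, ⟨⟨z, hz, rfl⟩, hz0⟩, rfl⟩
      exact ⟨_, neg_div_mem_ratAbscissa hz (fun h => hz0 (by simp [h])), by push_cast; rfl⟩
    · rw [Metric.mem_closure_iff]
      intro ε hε
      obtain ⟨z, hz, h1, h2⟩ := exists_mem_realAbscissa_Ioo h' hc' (lt_add_of_pos_right _ hε)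
      exact ⟨z, ⟨hz, (h'.trans h1).ne'⟩, by rw [Real.dist_eq, abs_lt]; constructor <;> linarith⟩
  · exact subset_closure ⟨0, ⟨0, by simp [cubic]⟩, by simp⟩
  · exact mem_closure_realAbscissa_of_pos h hc

/-! ### The plane cubic -/

/-- The homogeneous coordinates `(a, b, c)` of the point of the cubic `q = 0` that corresponds to
the point `(x, y)` of the Weierstrass curve. The inverse isomorphism is
`x = 6c / (2(a + b) + c) + 2`, `y = 12(a - b) / (2(a + b) + c)`. -/
def fromWeierstrass {R : Type*} [CommRing R] (x y : R) : Fin 3 → R :=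
  ![8 - x + y, 8 - x - y, 4 * x - 8]

theorem q_fromWeierstrass {R : Type*} [CommRing R] (x y : R) :
    q (fromWeierstrass x y) = 24 * (y ^ 2 - cubic x) := by
  simp [q, fromWeierstrass, cubic]
  ring

theorem fromWeierstrass_ne_zero {K : Type*} [Field K] [CharZero K] (x y : K) :
    fromWeierstrass x y ≠ 0 := by
  intro h
  have h0 : 8 - x + y = 0 := congrFun h 0
  have h1 : 8 - x - y = 0 := congrFun h 1
  have h2 : 4 * x - 8 = 0 := congrFun h 2
  have : (24 : K) = 0 := by linear_combination 2 * h0 + 2 * h1 + h2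
  norm_num at this

theorem coordCast_fromWeierstrass (x y : ℚ) :
    coordCast (fromWeierstrass x y) = fromWeierstrass (x : ℝ) (y : ℝ) := by
  ext i
  fin_cases i <;> simp [coordCast, fromWeierstrass]

theorem mk_mem_curve {K : Type*} [Field K] {v : Fin 3 → K} (hv : v ≠ 0) :
    Projectivization.mk K v hv ∈ curve K ↔ q v = 0 := Iff.rfl

theorem ratToReal_mk {v : Fin 3 → ℚ} (hv : v ≠ 0) {w : Fin 3 → ℝ} (hw : w ≠ 0)
    (h : coordCast v = w) : ratToReal (Projectivization.mk ℚ v hv) = Projectivization.mk ℝ w hw := by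
  subst h
  rfl

theorem isClosed_curve : IsClosed (curve ℝ) := by
  refine isClosed_coinduced.2 ?_
  have : Continuous (q : (Fin 3 → ℝ) → ℝ) := by
    unfold q
    fun_prop
  exact isClosed_singleton.preimage (t := {0}) (this.comp continuous_subtype_val)

theorem ratToReal_mem_curve {P : ℙ ℚ (Fin 3 → ℚ)} (hP : P ∈ curve ℚ) :
    ratToReal P ∈ curve ℝ := by
  induction P using Projectivization.ind with
  | h v hv =>
    have h : q v = 0 := hP
    have h' : q (coordCast v) = ((q v : ℚ) : ℝ) := by
      simp [q, coordCast]
    rw [h, Rat.cast_zero] at h'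
    exact h'

/-- Every affine real point of the Weierstrass curve is a limit of rational points. -/
theorem mem_closure_weierstrass {x y : ℝ} (h : y ^ 2 = cubic x) :
    (x, y) ∈ closure {p : ℝ × ℝ | ∃ r s : ℚ, s ^ 2 = cubic r ∧ p = (↑r, ↑s)} := by
  have hx : x ∈ closure realAbscissa := mem_closure_realAbscissa (h ▸ sq_nonneg y)
  have := continuous_cubic
  rcases le_total 0 y with hy | hy
  · have e : (x, y) = (fun z => (z, √(cubic z))) x := by simp [← h, Real.sqrt_sq hy]
    rw [e]
    refine map_mem_closure (f := fun z => (z, √(cubic z))) (by fun_prop) hx ?_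
    rintro _ ⟨r, hr, rfl⟩
    obtain ⟨s, hs, e⟩ := exists_sqrt_cubic_eq hr
    exact ⟨r, s, hs, by simp [e]⟩
  · have e : (x, y) = (fun z => (z, -√(cubic z))) x := by
      simp [← h, Real.sqrt_sq_eq_abs, abs_of_nonpos hy]
    rw [e]
    refine map_mem_closure (f := fun z => (z, -√(cubic z))) (by fun_prop) hx ?_
    rintro _ ⟨r, hr, rfl⟩
    obtain ⟨s, hs, e⟩ := exists_sqrt_cubic_eq hr
    exact ⟨r, -s, by rw [neg_sq, hs], by simp [e]⟩

theorem continuous_mk_fromWeierstrass : Continuous fun p : ℝ × ℝ =>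
    Projectivization.mk ℝ (fromWeierstrass p.1 p.2) (fromWeierstrass_ne_zero p.1 p.2) := by
  have hmk : Continuous (Projectivization.mk' ℝ : {v : Fin 3 → ℝ // v ≠ 0} → ℙ ℝ (Fin 3 → ℝ)) :=
    continuous_coinduced_rng
  have hv : Continuous fun p : ℝ × ℝ => fromWeierstrass p.1 p.2 := by
    refine continuous_pi fun i => ?_
    fin_cases i <;> simp only [fromWeierstrass] <;> dsimp <;> fun_prop
  exact hmk.comp (hv.subtype_mk fun p => fromWeierstrass_ne_zero p.1 p.2)

theorem mk_fromWeierstrass_mem_closure {x y : ℝ} (h : y ^ 2 = cubic x) :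
    Projectivization.mk ℝ (fromWeierstrass x y) (fromWeierstrass_ne_zero x y) ∈
      closure (ratToReal '' curve ℚ) := by
  refine map_mem_closure (f := fun p : ℝ × ℝ => Projectivization.mk ℝ (fromWeierstrass p.1 p.2)
    (fromWeierstrass_ne_zero p.1 p.2)) continuous_mk_fromWeierstrass (mem_closure_weierstrass h) ?_
  rintro _ ⟨r, s, hs, rfl⟩
  refine ⟨Projectivization.mk ℚ (fromWeierstrass r s) (fromWeierstrass_ne_zero r s), ?_,
    ratToReal_mk _ _ (coordCast_fromWeierstrass r s)⟩
  rw [mk_mem_curve, q_fromWeierstrass, hs, sub_self, mul_zero]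

theorem curve_subset_closure : curve ℝ ⊆ closure (ratToReal '' curve ℚ) := by
  intro P hP
  induction P using Projectivization.ind with
  | h v hv =>
    by_cases hz : 2 * (v 0 + v 1) + v 2 = 0
    · -- the line `2(a + b) + c = 0` meets the cubic only in the inflection point `(1 : -1 : 0)`
      have hv2 : v 2 = -2 * (v 0 + v 1) := by linear_combination hz
      have h01 : v 0 + v 1 = 0 := by
        rw [mk_mem_curve, q, hv2] at hP
        have : (v 0 + v 1) ^ 3 = 0 := by linear_combination (1 / 3) * hP
        exact pow_eq_zero_iff (by norm_num) |>.1 this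
      have hw : (![1, -1, 0] : Fin 3 → ℚ) ≠ 0 := fun h => by simpa using congrFun h 0
      have hw' : (![1, -1, 0] : Fin 3 → ℝ) ≠ 0 := fun h => by simpa using congrFun h 0
      refine subset_closure ⟨Projectivization.mk ℚ ![1, -1, 0] hw, ?_, ?_⟩
      · rw [mk_mem_curve]
        simp only [q]
        norm_num [Matrix.cons_val_two]
      · rw [ratToReal_mk hw hw' (by ext i; fin_cases i <;> simp [coordCast]), eq_comm,
          Projectivization.mk_eq_mk_iff']
        refine ⟨v 0, ?_⟩
        ext i
        fin_cases i
        · simp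
        · simp
          linarith
        · simp [hv2, h01]
    · set u := 2 * (v 0 + v 1) + v 2 with hu
      have hxy : Projectivization.mk ℝ v hv = Projectivization.mk ℝ
          (fromWeierstrass (6 * v 2 / u + 2) (12 * (v 0 - v 1) / u))
          (fromWeierstrass_ne_zero _ _) := by
        rw [Projectivization.mk_eq_mk_iff']
        refine ⟨u / 24, ?_⟩
        ext i
        fin_cases i <;> simp [fromWeierstrass] <;> field_simp <;> rw [hu] <;> ring
      rw [hxy, mk_mem_curve, q_fromWeierstrass] at hP
      rw [hxy]
      exact mk_fromWeierstrass_mem_closure (by linarith)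

theorem closure_rational_curve : closure (ratToReal '' curve ℚ) = curve ℝ := by
  refine (closure_minimal ?_ isClosed_curve).antisymm curve_subset_closure
  rintro _ ⟨P, hP, rfl⟩
  exact ratToReal_mem_curve hP

/-! ### Bisectral triangles -/

theorem side_pos (T : PlaneTriangle) (i : Fin 3) : 0 < side T i :=
  dist_pos.2 (T.independent.injective.ne (by fin_cases i <;> decide))

/-- The vector `‖w‖ v + ‖v‖ w` makes equal angles with `v` and `w`. -/
theorem angle_bisector {V : Type*} [NormedAddCommGroup V] [InnerProductSpace ℝ V] (v w : V)
    (hv : v ≠ 0) (hw : w ≠ 0) :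
    InnerProductGeometry.angle v (‖w‖ • v + ‖v‖ • w) =
      InnerProductGeometry.angle (‖w‖ • v + ‖v‖ • w) w := by
  have hv' : ‖v‖ ≠ 0 := norm_ne_zero_iff.2 hv
  have hw' : ‖w‖ ≠ 0 := norm_ne_zero_iff.2 hw
  rw [InnerProductGeometry.angle_comm v]
  unfold InnerProductGeometry.angle
  congr 1
  simp only [inner_add_left, real_inner_smul_left, real_inner_self_eq_norm_sq,
    real_inner_comm v w]
  rcases eq_or_ne ‖‖w‖ • v + ‖v‖ • w‖ 0 with h | h
  · simp [h]
  · field_simp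
    ring

/-- The foot of the internal bisector at the vertex `i`, given by the angle bisector theorem. -/
noncomputable def bisectorFoot (T : PlaneTriangle) (i : Fin 3) : Plane :=
  AffineMap.lineMap (T.points (i + 1)) (T.points (i + 2))
    (side T (i + 2) / (side T (i + 1) + side T (i + 2)))

theorem sbtw_bisectorFoot (T : PlaneTriangle) (i : Fin 3) :
    Sbtw ℝ (T.points (i + 1)) (bisectorFoot T i) (T.points (i + 2)) := by
  have h1 := side_pos T (i + 1)
  have h2 := side_pos T (i + 2)
  refine sbtw_lineMap_iff.2 ⟨T.independent.injective.ne (by fin_cases i <;> decide),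
    by positivity, ?_⟩
  rw [div_lt_one (by positivity)]
  linarith

theorem angle_bisectorFoot (T : PlaneTriangle) (i : Fin 3) :
    ∠ (T.points (i + 1)) (T.points i) (bisectorFoot T i) =
      ∠ (bisectorFoot T i) (T.points i) (T.points (i + 2)) := by
  have h1 := side_pos T (i + 1)
  have h2 := side_pos T (i + 2)
  have e1 : side T (i + 1) = ‖T.points (i + 2) -ᵥ T.points i‖ := by
    rw [← dist_eq_norm_vsub, side]
    fin_cases i <;> rfl
  have e2 : side T (i + 2) = ‖T.points (i + 1) -ᵥ T.points i‖ := by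
    rw [← dist_eq_norm_vsub, side, dist_comm]
    fin_cases i <;> rfl
  have e : bisectorFoot T i -ᵥ T.points i = (side T (i + 1) + side T (i + 2))⁻¹ •
      (side T (i + 1) • (T.points (i + 1) -ᵥ T.points i) +
        side T (i + 2) • (T.points (i + 2) -ᵥ T.points i)) := by
    simp only [bisectorFoot, AffineMap.lineMap_apply, vsub_eq_sub, vadd_eq_add]
    match_scalars <;> field_simp <;> ring
  have hp : 0 < (side T (i + 1) + side T (i + 2))⁻¹ := by positivity
  simp only [EuclideanGeometry.angle, e, InnerProductGeometry.angle_smul_left_of_pos _ _ hp,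
    InnerProductGeometry.angle_smul_right_of_pos _ _ hp]
  rw [e1, e2]
  exact angle_bisector _ _ (norm_pos_iff.1 (e2 ▸ h2)) (norm_pos_iff.1 (e1 ▸ h1))

/-- The bisectral triangle is nondegenerate: in barycentric coordinates, a vanishing combination of
the feet gives three numbers whose pairwise sums vanish. -/
theorem affineIndependent_bisectorFoot (T : PlaneTriangle) :
    AffineIndependent ℝ (bisectorFoot T) := by
  have h0 := side_pos T 0
  have h1 := side_pos T 1
  have h2 := side_pos T 2
  rw [affineIndependent_iff_of_fintype]
  intro w hw hsum
  rw [Finset.weightedVSub_eq_linear_combination _ hw, Fin.sum_univ_three] at hsum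
  rw [Fin.sum_univ_three] at hw
  obtain ⟨a, ha⟩ : ∃ a, a = side T 0 := ⟨_, rfl⟩
  obtain ⟨b, hb⟩ : ∃ b, b = side T 1 := ⟨_, rfl⟩
  obtain ⟨c, hc⟩ : ∃ c, c = side T 2 := ⟨_, rfl⟩
  have e0 : bisectorFoot T 0 = AffineMap.lineMap (T.points 1) (T.points 2) (c / (b + c)) := by
    rw [hb, hc]; rfl
  have e1 : bisectorFoot T 1 = AffineMap.lineMap (T.points 2) (T.points 0) (a / (c + a)) := by
    rw [ha, hc]; rfl
  have e2 : bisectorFoot T 2 = AffineMap.lineMap (T.points 0) (T.points 1) (b / (a + b)) := by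
    rw [ha, hb]; rfl
  rw [← ha] at h0
  rw [← hb] at h1
  rw [← hc] at h2
  have key := (affineIndependent_iff_of_fintype ℝ T.points).1 T.independent
    ![a * (w 1 / (c + a) + w 2 / (a + b)), b * (w 0 / (b + c) + w 2 / (a + b)),
      c * (w 0 / (b + c) + w 1 / (c + a))] (by
        simp [Fin.sum_univ_three]
        rw [← hw]
        field_simp
        ring) (by
        rw [Finset.weightedVSub_eq_linear_combination _ (by
          simp [Fin.sum_univ_three]
          rw [← hw]
          field_simp
          ring), Fin.sum_univ_three, ← hsum, e0, e1, e2]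
        simp [AffineMap.lineMap_apply]
        match_scalars <;> field_simp <;> ring)
  have k0 : a * (w 1 / (c + a) + w 2 / (a + b)) = 0 := key 0
  have k1 : b * (w 0 / (b + c) + w 2 / (a + b)) = 0 := key 1
  have k2 : c * (w 0 / (b + c) + w 1 / (c + a)) = 0 := key 2
  replace k0 := (mul_eq_zero.1 k0).resolve_left h0.ne'
  replace k1 := (mul_eq_zero.1 k1).resolve_left h1.ne'
  replace k2 := (mul_eq_zero.1 k2).resolve_left h2.ne'
  intro i
  fin_cases i
  · exact (div_eq_zero_iff.1 (by linarith : w 0 / (b + c) = 0)).resolve_right (by positivity)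
  · exact (div_eq_zero_iff.1 (by linarith : w 1 / (c + a) = 0)).resolve_right (by positivity)
  · exact (div_eq_zero_iff.1 (by linarith : w 2 / (a + b) = 0)).resolve_right (by positivity)

/-- The bisectral triangle of `T`, with vertices the feet of the internal bisectors. -/
noncomputable def bisectralTriangle (T : PlaneTriangle) : PlaneTriangle :=
  ⟨bisectorFoot T, affineIndependent_bisectorFoot T⟩

theorem isBisectral_bisectralTriangle (T : PlaneTriangle) : IsBisectral T (bisectralTriangle T) :=
  fun i => ⟨sbtw_bisectorFoot T i, angle_bisectorFoot T i⟩

/-- If the side lengths satisfy `q = 0`, the bisectral triangle has two equal sides at the foot of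
the bisector of the third angle. -/
theorem isIsosceles_bisectralTriangle (T : PlaneTriangle) (h : q (side T) = 0) :
    IsIsosceles (bisectralTriangle T) := by
  refine ⟨0, 1, by decide, ?_⟩
  change dist (bisectorFoot T 1) (bisectorFoot T 2) = dist (bisectorFoot T 2) (bisectorFoot T 0)
  have h0 := side_pos T 0
  have h1 := side_pos T 1
  have h2 := side_pos T 2
  obtain ⟨a, ha⟩ : ∃ a, a = side T 0 := ⟨_, rfl⟩
  obtain ⟨b, hb⟩ : ∃ b, b = side T 1 := ⟨_, rfl⟩
  obtain ⟨c, hc⟩ : ∃ c, c = side T 2 := ⟨_, rfl⟩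
  have e0 : bisectorFoot T 0 = AffineMap.lineMap (T.points 1) (T.points 2) (c / (b + c)) := by
    rw [hb, hc]; rfl
  have e1 : bisectorFoot T 1 = AffineMap.lineMap (T.points 2) (T.points 0) (a / (c + a)) := by
    rw [ha, hc]; rfl
  have e2 : bisectorFoot T 2 = AffineMap.lineMap (T.points 0) (T.points 1) (b / (a + b)) := by
    rw [ha, hb]; rfl
  obtain ⟨u, hu⟩ : ∃ u, u = T.points 0 - T.points 2 := ⟨_, rfl⟩
  obtain ⟨v, hv⟩ : ∃ v, v = T.points 1 - T.points 2 := ⟨_, rfl⟩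
  have nu : ‖u‖ = b := by rw [hu, hb, ← dist_eq_norm, dist_comm]; rfl
  have nv : ‖v‖ = a := by rw [hv, ha, ← dist_eq_norm]; rfl
  have nuv : ‖u - v‖ = c := by rw [hu, hv, hc, sub_sub_sub_cancel_right, ← dist_eq_norm]; rfl
  have hin : 2 * inner ℝ u v = a ^ 2 + b ^ 2 - c ^ 2 := by
    have := norm_sub_sq_real u v
    rw [nu, nv, nuv] at this
    linarith
  have hnorm (s t : ℝ) : ‖s • u + t • v‖ ^ 2 =
      s ^ 2 * b ^ 2 + s * t * (a ^ 2 + b ^ 2 - c ^ 2) + t ^ 2 * a ^ 2 := by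
    rw [norm_add_sq_real, norm_smul, norm_smul, real_inner_smul_left, real_inner_smul_right,
      mul_pow, mul_pow, Real.norm_eq_abs, Real.norm_eq_abs, sq_abs, sq_abs, nu, nv, ← hin]
    ring
  simp only [q, ← ha, ← hb, ← hc] at h
  rw [← ha] at h0
  rw [← hb] at h1
  rw [← hc] at h2
  have d12 : bisectorFoot T 1 - bisectorFoot T 2 =
      (a / (c + a) - a / (a + b)) • u + (-(b / (a + b))) • v := by
    rw [e1, e2, hu, hv]
    simp only [AffineMap.lineMap_apply, vsub_eq_sub, vadd_eq_add]
    match_scalars <;> field_simp <;> ring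
  have d20 : bisectorFoot T 2 - bisectorFoot T 0 =
      (a / (a + b)) • u + (b / (a + b) - b / (b + c)) • v := by
    rw [e0, e2, hu, hv]
    simp only [AffineMap.lineMap_apply, vsub_eq_sub, vadd_eq_add]
    match_scalars <;> field_simp <;> ring
  rw [dist_eq_norm, dist_eq_norm, ← sq_eq_sq₀ (norm_nonneg _) (norm_nonneg _), d12, d20, hnorm,
    hnorm]
  field_simp
  linear_combination c * (a - b) * (a + b) * h

/-! ### Integer Sharygin triangles -/

/-- Positive numbers satisfying the strict triangle inequalities are the side lengths of a
triangle. -/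
theorem exists_side_eq {s : Fin 3 → ℝ} (h : ∀ i, 0 < s i) (h0 : s 0 < s 1 + s 2)
    (h1 : s 1 < s 2 + s 0) (h2 : s 2 < s 0 + s 1) : ∃ T : PlaneTriangle, side T = s := by
  obtain ⟨a, ha⟩ : ∃ a, a = s 0 := ⟨_, rfl⟩
  obtain ⟨b, hb⟩ : ∃ b, b = s 1 := ⟨_, rfl⟩
  obtain ⟨c, hc⟩ : ∃ c, c = s 2 := ⟨_, rfl⟩
  have pa := h 0
  have pb := h 1
  have pc := h 2
  rw [← ha] at h0 h1 h2 pa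
  rw [← hb] at h0 h1 h2 pb
  rw [← hc] at h0 h1 h2 pc
  -- the third vertex `(u, t)` over the base of length `c`
  obtain ⟨u, hu⟩ : ∃ u, u = (b ^ 2 + c ^ 2 - a ^ 2) / (2 * c) := ⟨_, rfl⟩
  have hu' : 2 * c * u = b ^ 2 + c ^ 2 - a ^ 2 := by
    rw [hu]
    field_simp
  have hub : u ^ 2 ≤ b ^ 2 := by
    refine sq_le_sq' ?_ ?_ <;> by_contra! hlt <;> nlinarith
  obtain ⟨t, ht⟩ : ∃ t, t = √(b ^ 2 - u ^ 2) := ⟨_, rfl⟩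
  have ht' : t ^ 2 = b ^ 2 - u ^ 2 := by
    rw [ht, Real.sq_sqrt (by linarith)]
  let p : Fin 3 → Plane := ![!₂[0, 0], !₂[c, 0], !₂[u, t]]
  have d0 : dist (p 1) (p 2) = a := by
    rw [EuclideanSpace.dist_eq, Real.sqrt_eq_iff_eq_sq (by positivity) pa.le]
    simp [p, Real.dist_eq]
    linarith
  have d1 : dist (p 2) (p 0) = b := by
    rw [EuclideanSpace.dist_eq, Real.sqrt_eq_iff_eq_sq (by positivity) pb.le]
    simp [p, Real.dist_eq]
    linarith
  have d2 : dist (p 0) (p 1) = c := by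
    rw [EuclideanSpace.dist_eq, Real.sqrt_eq_iff_eq_sq (by positivity) pc.le]
    simp [p, Real.dist_eq]
  have hind : AffineIndependent ℝ p := by
    have hp : p = ![p 0, p 1, p 2] := by
      ext i
      fin_cases i <;> rfl
    rw [hp, affineIndependent_iff_not_collinear_set]
    intro hcol
    rcases hcol.wbtw_or_wbtw_or_wbtw with hw | hw | hw <;>
      have hd := hw.dist_add_dist
    · rw [d2, d0, dist_comm, d1] at hd
      linarith
    · rw [d0, d1, dist_comm, d2] at hd
      linarith
    · rw [d1, d2, dist_comm, d0] at hd
      linarith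
  refine ⟨⟨p, hind⟩, ?_⟩
  ext i
  fin_cases i
  · exact d0.trans ha
  · exact d1.trans hb
  · exact d2.trans hc

/-- Proportional side vectors that are both increasing match without any permutation. -/
theorem AreSimilar.exists_side_eq {T₁ T₂ : PlaneTriangle} (h : AreSimilar T₁ T₂)
    (h₁ : StrictMono (side T₁)) (h₂ : StrictMono (side T₂)) :
    ∃ r : ℝ, ∀ i, side T₁ i = r * side T₂ i := by
  obtain ⟨σ, hσ⟩ := h
  obtain ⟨r, hr, hd⟩ := similar_iff_exists_dist_eq.1 hσ
  have hr0 : (0 : ℝ) < r := by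
    have := pos_iff_ne_zero.2 hr
    exact_mod_cast this
  have hperm : ∀ (σ : Equiv.Perm (Fin 3)) (i : Fin 3),
      (σ (i + 1) = σ i + 1 ∧ σ (i + 2) = σ i + 2) ∨
        (σ (i + 1) = σ i + 2 ∧ σ (i + 2) = σ i + 1) := by
    decide
  have hside (i : Fin 3) : side T₁ (σ i) = r * side T₂ i := by
    have := hd (i + 1) (i + 2)
    simp only [Function.comp_apply] at this
    rw [side, side, ← this]
    rcases hperm σ i with ⟨e1, e2⟩ | ⟨e1, e2⟩
    · rw [e1, e2]
    · rw [e1, e2, dist_comm]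
  have hlt (i j : Fin 3) (hij : i < j) : σ i < σ j := by
    rw [← h₁.lt_iff_lt, hside, hside]
    exact mul_lt_mul_of_pos_left (h₂ hij) hr0
  have hone : ∀ σ : Equiv.Perm (Fin 3), σ 0 < σ 1 → σ 1 < σ 2 → σ = 1 := by decide
  refine ⟨r, fun i => ?_⟩
  rw [← hside, hone σ (hlt 0 1 (by decide)) (hlt 1 2 (by decide))]
  rfl

/-- On the arc `39/10 < x < 4`, `y < 0` of the Weierstrass curve, the homogeneous coordinates
`(a, b, c)` are the sides of a triangle, with `a < b < c`. The bound `39/10` only serves to keep `x`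
above the largest root `(3√17 - 5) / 2` of the cubic. -/
theorem exists_sharygin {x : ℝ} (hx : x ∈ realAbscissa) (h1 : 39 / 10 < x) (h2 : x < 4) :
    ∃ T : PlaneTriangle, IsInteger T ∧ IsSharygin T ∧ StrictMono (side T) ∧
      ∃ k : ℝ, side T = k • fromWeierstrass x (-√(cubic x)) := by
  have hc : 0 < cubic x := by
    simp only [cubic]
    nlinarith
  obtain ⟨x, hx, rfl⟩ := hx
  obtain ⟨y, hy, hs⟩ := exists_sqrt_cubic_eq hx
  have hy0 : 0 < (y : ℝ) := hs ▸ Real.sqrt_pos.2 hc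
  have hyR : (y : ℝ) ^ 2 = cubic (x : ℝ) := by rw [← cast_cubic, ← hy]; push_cast; rfl
  have hyc := hyR
  simp only [cubic] at hyR
  rw [hs]
  -- `b < c`: the curve meets the line `y = 16 - 5x` where `(x - 4)(x - 8)² = 0`
  have hbc : (y : ℝ) < 5 * x - 16 := by
    refine lt_of_pow_lt_pow_left₀ 2 (by linarith) ?_
    have : 0 < (4 - (x : ℝ)) * (x - 8) ^ 2 := by
      have : (x : ℝ) - 8 ≠ 0 := by linarith
      have := sub_pos.2 h2
      positivity
    linarith
  have ha : (y : ℝ) < 8 - x := by linarith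
  -- clear the denominators
  obtain ⟨k, m, n, hk, hm, hn⟩ : ∃ k m n : ℤ, (0 : ℝ) < k ∧ k * (x : ℝ) = m ∧ k * (y : ℝ) = n := by
    refine ⟨x.den * y.den, x.num * y.den, y.num * x.den, ?_, ?_, ?_⟩
    · have := x.den_pos
      have := y.den_pos
      push_cast
      positivity
    · have : (x : ℝ) * x.den = x.num := by exact_mod_cast x.mul_den_eq_num
      push_cast
      rw [← this]
      ring
    · have : (y : ℝ) * y.den = y.num := by exact_mod_cast y.mul_den_eq_num
      push_cast
      rw [← this]
      ring
  obtain ⟨v, hv⟩ : ∃ v : Fin 3 → ℝ, v = (k : ℝ) • fromWeierstrass (x : ℝ) (-y : ℝ) := ⟨_, rfl⟩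
  have v0 : v 0 = k * (8 - x - y) := by simp [hv, fromWeierstrass, sub_eq_add_neg]
  have v1 : v 1 = k * (8 - x + y) := by simp [hv, fromWeierstrass]
  have v2 : v 2 = k * (4 * x - 8) := by simp [hv, fromWeierstrass]
  have hmono : StrictMono v := by
    rw [Fin.strictMono_iff_lt_succ]
    intro i
    fin_cases i
    · change v 0 < v 1
      rw [v0, v1]
      exact mul_lt_mul_of_pos_left (by linarith) hk
    · change v 1 < v 2
      rw [v1, v2]
      exact mul_lt_mul_of_pos_left (by linarith) hk
  have h01 : v 0 < v 1 := hmono (by decide)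
  have h12 : v 1 < v 2 := hmono (by decide)
  have hv0 : 0 < v 0 := v0 ▸ mul_pos hk (by linarith)
  have htri : v 2 < v 0 + v 1 := by
    rw [v0, v1, v2, ← mul_add]
    exact mul_lt_mul_of_pos_left (by linarith) hk
  obtain ⟨T, hT⟩ := exists_side_eq (s := v) (by intro i; fin_cases i <;> dsimp <;> linarith)
    (by linarith) (by linarith) htri
  have hsc : IsScalene T := by
    rw [IsScalene, hT]
    exact hmono.injective
  refine ⟨T, fun i => ?_, ⟨hsc, bisectralTriangle T,
    isBisectral_bisectralTriangle T, isIsosceles_bisectralTriangle T ?_⟩, hT ▸ hmono, k, hT.trans hv⟩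
  · rw [hT]
    fin_cases i
    · exact ⟨8 * k - m - n, by push_cast; rw [← hm, ← hn]; exact v0.trans (by ring)⟩
    · exact ⟨8 * k - m + n, by push_cast; rw [← hm, ← hn]; exact v1.trans (by ring)⟩
    · exact ⟨4 * m - 8 * k, by push_cast; rw [← hm]; exact v2.trans (by ring)⟩
  · rw [hT, hv, q_smul, q_fromWeierstrass, neg_sq, hyc, sub_self, mul_zero, mul_zero]

/-- The abscissa is determined by the point of the projective plane. -/
theorem eq_of_smul_fromWeierstrass_eq {K : Type*} [Field K] [CharZero K] {x y x' y' k k' : K}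
    (hk : k ≠ 0) (h : k • fromWeierstrass x y = k' • fromWeierstrass x' y') : x = x' := by
  have h0 : k * (8 - x + y) = k' * (8 - x' + y') := congrFun h 0
  have h1 : k * (8 - x - y) = k' * (8 - x' - y') := congrFun h 1
  have h2 : k * (4 * x - 8) = k' * (4 * x' - 8) := congrFun h 2
  obtain rfl : k = k' := by linear_combination (2 * h0 + 2 * h1 + h2) / 24
  have := mul_left_cancel₀ hk h2
  linear_combination this / 4

theorem infinite_realAbscissa_Ioo : (realAbscissa ∩ Set.Ioo (39 / 10) 4).Infinite := by
  have hc : (0 : ℝ) ≤ cubic (39 / 10) := by norm_num [cubic]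
  intro hfin
  obtain ⟨z, hz, h1, h2⟩ := exists_mem_realAbscissa_Ioo (by norm_num) hc
    (by norm_num : (39 / 10 : ℝ) < 4)
  obtain ⟨x, hx, hmin⟩ := Set.exists_min_image _ id hfin ⟨z, hz, h1, h2⟩
  obtain ⟨w, hw, h3, h4⟩ := exists_mem_realAbscissa_Ioo (by norm_num) hc hx.2.1
  exact absurd (hmin w ⟨hw, h3, h4.trans hx.2.2⟩) (not_le.2 h4)

theorem exists_infinite_nonsimilar_sharygin :
    ∃ S : Set PlaneTriangle, S.Infinite ∧ (∀ T ∈ S, IsInteger T ∧ IsSharygin T) ∧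
      S.Pairwise (fun T₁ T₂ => ¬ AreSimilar T₁ T₂) := by
  have hex : ∀ x ∈ realAbscissa ∩ Set.Ioo (39 / 10) 4, ∃ T : PlaneTriangle,
      IsInteger T ∧ IsSharygin T ∧ StrictMono (side T) ∧
        ∃ k : ℝ, side T = k • fromWeierstrass x (-√(cubic x)) :=
    fun x hx => exists_sharygin hx.1 hx.2.1 hx.2.2
  have : Nonempty PlaneTriangle :=
    let ⟨x, hx⟩ := infinite_realAbscissa_Ioo.nonempty
    ⟨(hex x hx).choose⟩
  choose! T hint hsh hmono k hside using hex
  have key : ∀ x ∈ realAbscissa ∩ Set.Ioo (39 / 10) 4,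
      ∀ x' ∈ realAbscissa ∩ Set.Ioo (39 / 10) 4, AreSimilar (T x) (T x') → x = x' := by
    intro x hx x' hx' h
    obtain ⟨r, hr⟩ := h.exists_side_eq (hmono x hx) (hmono x' hx')
    have hk : k x ≠ 0 := by
      intro h0
      have := side_pos (T x) 0
      rw [hside x hx, h0, zero_smul] at this
      exact this.ne rfl
    refine eq_of_smul_fromWeierstrass_eq (k' := r * k x') (y := -√(cubic x))
      (y' := -√(cubic x')) hk ?_
    rw [← hside x hx, mul_smul, ← hside x' hx']
    exact funext hr
  refine ⟨T '' (realAbscissa ∩ Set.Ioo (39 / 10) 4),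
    infinite_realAbscissa_Ioo.image fun x hx x' hx' h => key x hx x' hx' ?_, ?_, ?_⟩
  · exact h ▸ ⟨1, by simpa using Similar.refl _⟩
  · rintro _ ⟨x, hx, rfl⟩
    exact ⟨hint x hx, hsh x hx⟩
  · rintro _ ⟨x, hx, rfl⟩ _ ⟨x', hx', rfl⟩ hne h
    exact hne (congrArg T (key x hx x' hx' h))

end Sharygin

theorem mainTheorem1 :
    closure (Sharygin.ratToReal '' Sharygin.curve ℚ) = Sharygin.curve ℝ ∧
      ∃ S : Set Sharygin.PlaneTriangle, S.Infinite ∧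
        (∀ T ∈ S, Sharygin.IsInteger T ∧ Sharygin.IsSharygin T) ∧
        S.Pairwise (fun T₁ T₂ => ¬ Sharygin.AreSimilar T₁ T₂) :=
  ⟨Sharygin.closure_rational_curve, Sharygin.exists_infinite_nonsimilar_sharygin⟩
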